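/- Let $q$ be a prime power, let $r>h\ge 1$ be integers, and let $V$ be an $r$-dimensional vector space over $\mathbb{F}_q$. Write $[i]_q:=\frac{q^i-1}{q-1}$. An $i$-space is an $i$-dimensional $\mathbb{F}_q$-subspace of $V$, a point is a $1$-space, and for a subspace $S\le V$ let $\chi_S$ be its characteristic function on the set of points, i.e. $\chi_S(P)=1$ if $P\le S$ and $\chi_S(P)=0$ otherwise. Let $\varepsilon_1,\dots,\varepsilon_{r-1}\in\mathbb{Z}$. We say that $\star[r]-\sum_{i=1}^{r-1}\varepsilon_i[i]$ is $h$-partitionable over $\mathbb{F}_q$ if there exist $\sigma\in\mathbb{N}=\{0,1,2,\dots\}$, subspaces $S_1\le S_2\le\dots\le S_{r-1}$ of $V$ with $\dim(S_i)=i$ for all $i$, and a finite multiset $\mathcal{S}$ of $h$-spaces of $V$ such that $$\sum_{S\in\mathcal{S}}\chi_S=\sigma\cdot\chi_V-\sum_{i=1}^{r-1}\varepsilon_i\cdot\chi_{S_i}.$$ Then $\star[r]-\sum_{i=1}^{r-1}\varepsilon_i[i]$ is $h$-partitionable over $\mathbb{F}_q$ if and only if both of the following conditions hold: 1. $q^{h-i}$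 divides $\varepsilon_i$ for all $1\le i<h$; 2. $\sum_{i=1}^{r-1}\varepsilon_i\cdot[i]_q\equiv 0\pmod{[\gcd(r,h)]_q}$. -/

import Mathlib

open scoped LinearAlgebra.Projectivization

noncomputable section

namespace AdditiveCodes

/-- The `q`-number `[i]_q = 1 + q + ⋯ + q ^ (i - 1)`, the number of points of an `i`-space
over the field with `q` elements. -/
def qNumber (q i : ℕ) : ℕ := ∑ j ∈ Finset.range i, q ^ j

variable {F V : Type*} [Field F] [AddCommGroup V] [Module F V]

open Classical in
/-- The characteristic function of a subspace `S`, as an integer-valued function on the points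
of the projective space of `V`: it is `1` on the points contained in `S` and `0` elsewhere. -/
def chi (S : Submodule F V) : ℙ F V → ℤ :=
  fun P => if P.submodule ≤ S then 1 else 0

open Classical in
/-- The number of elements (with multiplicity) of a multiset of subspaces contained in `H`. -/
def numContained (𝒮 : Multiset (Submodule F V)) (H : Submodule F V) : ℕ :=
  (𝒮.filter (fun S => S ≤ H)).card

/-- Hyperplanes are the subspaces of codimension one. -/
def IsHyperplane (H : Submodule F V) : Prop :=
  Module.finrank F H + 1 = Module.finrank F V

/-- A projective `h-(n, r, s)_q` system, where `r = dim V` and `F` has `q` elements: a multiset of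
`n` subspaces of dimension at most `h` such that every hyperplane contains at most `s` of them
and some hyperplane contains exactly `s` of them. -/
structure IsProjectiveSystem (h n s : ℕ) (𝒮 : Multiset (Submodule F V)) : Prop where
  card_eq : Multiset.card 𝒮 = n
  finrank_le : ∀ S ∈ 𝒮, Module.finrank F S ≤ h
  numContained_le : ∀ H : Submodule F V, IsHyperplane H → numContained 𝒮 H ≤ s
  exists_numContained_eq : ∃ H : Submodule F V, IsHyperplane H ∧ numContained 𝒮 H = s

/-- A faithful projective system: all elements have dimension exactly `h`. -/
structure IsFaithfulProjectiveSystem (h n s : ℕ) (𝒮 : Multiset (Submodule F V)) : Prop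
    extends IsProjectiveSystem h n s 𝒮 where
  finrank_eq : ∀ S ∈ 𝒮, Module.finrank F S = h

/-- `S 1 ≤ S 2 ≤ ⋯ ≤ S (r - 1)` with `dim (S i) = i`, where `r = dim V`. Only the values `S i`
with `1 ≤ i < r` matter. -/
def IsFlag (S : ℕ → Submodule F V) : Prop :=
  MonotoneOn S (Set.Ico 1 (Module.finrank F V)) ∧
    ∀ i ∈ Set.Ico 1 (Module.finrank F V), Module.finrank F (S i) = i

/-- `𝒮` has type `σ[r] - ∑_{i=1}^{r-1} ε_i [i]`, where `r = dim V`. -/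
def HasType (𝒮 : Multiset (Submodule F V)) (σ : ℕ) (ε : ℕ → ℤ) : Prop :=
  ∃ S : ℕ → Submodule F V, IsFlag S ∧
    (𝒮.map chi).sum =
      (σ : ℤ) • chi (⊤ : Submodule F V) -
        ∑ i ∈ Finset.Ico 1 (Module.finrank F V), ε i • chi (S i)

variable (F V) in
/-- `σ[r] - ∑_{i=1}^{r-1} ε_i [i]` is `h`-partitionable over `F`, where `r = dim V`. -/
def IsPartitionable (h σ : ℕ) (ε : ℕ → ℤ) : Prop :=
  ∃ (n s : ℕ) (𝒮 : Multiset (Submodule F V)),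
    IsFaithfulProjectiveSystem h n s 𝒮 ∧ HasType 𝒮 σ ε

variable (F V) in
/-- `⋆[r] - ∑_{i=1}^{r-1} ε_i [i]` is `h`-partitionable over `F`, where `r = dim V`. -/
def IsStarPartitionable (h : ℕ) (ε : ℕ → ℤ) : Prop :=
  ∃ σ : ℕ, IsPartitionable F V h σ ε

end AdditiveCodes

end

noncomputable section

namespace AdditiveCodes

/-! Necessity. Outside a hyperplane an `h`-space has either 0 or q^(h-1) points. Comparing a
hyperplane that contains S_{i-1} but not S_i with one that contains S_i but not S_{i+1} isolates ε_i
q^(i-1), which q^(h-1) must then divide (`dvd_of_hasType`). Counting all points modulo gcd([r],[h])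
= [gcd(r,h)] gives the congruence (`modEq_of_hasType`).

Sufficiency. Let L be the lattice spanned by the χ_S of `h`-spaces, and fix an (h+1)-space W. Modulo
L, χ_U ≡ deg(χ_U) χ_W when dim U ≥ h, and the same holds for q^(h-i) χ_S when dim S = i ≤ h. Hence
condition 1 makes the right-hand side f congruent to deg(f) χ_W. As [h] χ_W ∈ L, f lies in L once
[h] divides deg(f); condition 2 is what allows a choice of σ achieving this
(`smul_chi_top_sub_sum_mem_spaceLattice`). Negative coefficients disappear on adding all `h`-spaces
equally often, which only raises σ (`exists_multiset_of_mem_spaceLattice`). -/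

lemma qNumber_one (q : ℕ) : qNumber q 1 = 1 := by simp [qNumber]

lemma qNumber_succ (q i : ℕ) : qNumber q (i + 1) = q * qNumber q i + 1 := geom_sum_succ

lemma qNumber_succ' (q i : ℕ) : qNumber q (i + 1) = q ^ i + qNumber q i := geom_sum_succ'

lemma qNumber_mul_pred {q : ℕ} (hq : 1 < q) (i : ℕ) : qNumber q i * (q - 1) = q ^ i - 1 := by
  obtain ⟨p, rfl⟩ : ∃ p, q = p + 1 := ⟨q - 1, by omega⟩
  have := geom_sum_mul_add p i
  simp only [qNumber, Nat.add_sub_cancel]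
  omega

lemma gcd_qNumber {q : ℕ} (hq : 1 < q) (m n : ℕ) :
    Nat.gcd (qNumber q m) (qNumber q n) = qNumber q (Nat.gcd m n) := by
  refine Nat.eq_of_mul_eq_mul_right (by omega : 0 < q - 1) ?_
  rw [← Nat.gcd_mul_right, qNumber_mul_pred hq, qNumber_mul_pred hq, qNumber_mul_pred hq,
    Nat.pow_sub_one_gcd_pow_sub_one]

variable {F V : Type*} [Field F] [AddCommGroup V] [Module F V]

/-! ### Points, characteristic functions and degree -/

lemma submodule_le_iff_rep_mem (P : ℙ F V) (S : Submodule F V) :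
    P.submodule ≤ S ↔ P.rep ∈ S := by
  rw [P.submodule_eq, Submodule.span_singleton_le_iff_mem]

lemma chi_of_le {S : Submodule F V} {P : ℙ F V} (hP : P.submodule ≤ S) : chi S P = 1 := if_pos hP

lemma chi_of_not_le {S : Submodule F V} {P : ℙ F V} (hP : ¬ P.submodule ≤ S) : chi S P = 0 :=
  if_neg hP

lemma chi_top (P : ℙ F V) : chi (⊤ : Submodule F V) P = 1 := chi_of_le le_top

lemma chi_bot : chi (⊥ : Submodule F V) = 0 := by
  funext P
  refine chi_of_not_le fun hP => P.rep_nonzero ?_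
  simpa using (submodule_le_iff_rep_mem P ⊥).1 hP

lemma chi_inf (S T : Submodule F V) : chi (S ⊓ T) = chi S * chi T := by
  funext P
  by_cases hS : P.submodule ≤ S <;> by_cases hT : P.submodule ≤ T <;>
    simp [chi, hS, hT]

/-- The points of `V` contained in `S` are the points of the vector space `S`. -/
def pointsEquiv (S : Submodule F V) : ℙ F S ≃ {P : ℙ F V // P.submodule ≤ S} :=
  Equiv.ofBijective
    (fun p => ⟨p.map S.subtype S.injective_subtype, by
      induction p using Projectivization.ind with
      | h v hv => simp [Projectivization.map_mk, Projectivization.submodule_mk]⟩) <| by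
    refine ⟨fun p p' hp => Projectivization.map_injective _ S.injective_subtype
      (congrArg Subtype.val hp), ?_⟩
    rintro ⟨P, hP⟩
    have hv := (submodule_le_iff_rep_mem P S).1 hP
    refine ⟨Projectivization.mk F ⟨P.rep, hv⟩ fun h0 => P.rep_nonzero (congrArg Subtype.val h0), ?_⟩
    apply Subtype.ext
    simp [Projectivization.map_mk]

lemma card_points [Finite F] (S : Submodule F V) :
    Nat.card {P : ℙ F V // P.submodule ≤ S} = qNumber (Nat.card F) (Module.finrank F S) := by
  rw [← Nat.card_congr (pointsEquiv S), Projectivization.card_of_finrank F S rfl, qNumber]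

/-- The sum of an integer-valued function over all points, as a linear map. -/
def degree (F V : Type*) [Field F] [AddCommGroup V] [Module F V] [Fintype (ℙ F V)] :
    (ℙ F V → ℤ) →ₗ[ℤ] ℤ := ∑ P, LinearMap.proj P

lemma degree_apply [Fintype (ℙ F V)] (f : ℙ F V → ℤ) : degree F V f = ∑ P, f P := by
  simp [degree]

lemma degree_chi [Finite F] [Fintype (ℙ F V)] (S : Submodule F V) :
    degree F V (chi S) = qNumber (Nat.card F) (Module.finrank F S) := by
  classical
  rw [← card_points S, degree_apply, Nat.card_eq_fintype_card, Fintype.card_subtype]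
  simp [chi]

/-! ### Hyperplanes of U through B -/

/-- The subspace of `U` containing `B` that is cut out by a linear form on `U / B`. -/
def cut (B U : Submodule F V) (φ : Module.Dual F (U ⧸ B.comap U.subtype)) : Submodule F V :=
  (LinearMap.ker (φ ∘ₗ (B.comap U.subtype).mkQ)).map U.subtype

lemma finrank_cut [FiniteDimensional F V] {B U : Submodule F V} {φ : Module.Dual F (U ⧸ B.comap U.subtype)}
    (hφ : φ ≠ 0) : Module.finrank F (cut B U φ) + 1 = Module.finrank F U := by
  rw [cut, Submodule.finrank_map_subtype_eq]
  refine Module.Dual.finrank_ker_add_one_of_ne_zero fun h0 => hφ ?_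
  exact (LinearMap.cancel_right (Submodule.mkQ_surjective _)).1 
    (h0.trans (LinearMap.zero_comp _).symm)

lemma le_cut_iff {B U : Submodule F V} (φ : Module.Dual F (U ⧸ B.comap U.subtype)) (P : ℙ F V) :
    P.submodule ≤ cut B U φ ↔
      ∃ hP : P.rep ∈ U, φ (Submodule.Quotient.mk ⟨P.rep, hP⟩) = 0 := by
  rw [submodule_le_iff_rep_mem, cut, Submodule.mem_map]
  constructor
  · rintro ⟨⟨x, hx⟩, h1, rfl⟩
    exact ⟨hx, h1⟩
  · rintro ⟨hP, h1⟩
    exact ⟨⟨P.rep, hP⟩, h1, rfl⟩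

lemma finrank_dual_quotient [FiniteDimensional F V] {B U : Submodule F V} (hBU : B ≤ U) {m : ℕ}
    (hm : Module.finrank F U = Module.finrank F B + m) :
    Module.finrank F (Module.Dual F (U ⧸ B.comap U.subtype)) = m := by
  rw [Subspace.dual_finrank_eq]
  have h1 := (B.comap U.subtype).finrank_quotient_add_finrank
  have h2 : Module.finrank F (B.comap U.subtype) = Module.finrank F B :=
    (Submodule.comapSubtypeEquivOfLe hBU).finrank_eq
  omega

/-- The sum of the characteristic functions of all hyperplanes of `U` through `B`. -/
lemma sum_chi_cut [Finite F] [FiniteDimensional F V] {B U : Submodule F V} (hBU : B ≤ U) {m : ℕ}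
    (hm : Module.finrank F U = Module.finrank F B + (m + 1))
    [Fintype (ℙ F (Module.Dual F (U ⧸ B.comap U.subtype)))] :
    ∑ p : ℙ F (Module.Dual F (U ⧸ B.comap U.subtype)), chi (cut B U p.rep) =
      qNumber (Nat.card F) m • chi U + (Nat.card F) ^ m • chi B := by
  classical
  have hd := finrank_dual_quotient hBU hm
  funext P
  simp only [Finset.sum_apply, Pi.add_apply, Pi.smul_apply]
  by_cases hPU : P.submodule ≤ U
  · have hP := (submodule_le_iff_rep_mem P U).1 hPU
    set x : U ⧸ B.comap U.subtype := Submodule.Quotient.mk ⟨P.rep, hP⟩ with hx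
    have hx0 : x = 0 ↔ P.submodule ≤ B := by
      rw [hx, Submodule.Quotient.mk_eq_zero, submodule_le_iff_rep_mem]; rfl
    -- By duality, the hyperplanes of U through B and P are the points of the annihilator K of x. It
    -- has dimension m + 1 if P lies in B, and m otherwise.
    set K := LinearMap.ker (Module.Dual.eval F _ x) with hK
    have hsum : ∑ p : ℙ F (Module.Dual F (U ⧸ B.comap U.subtype)), chi (cut B U p.rep) P =
        qNumber (Nat.card F) (Module.finrank F K) := by
      rw [← degree_chi, degree_apply]
      refine Finset.sum_congr rfl fun p _ => ?_
      have : P.submodule ≤ cut B U p.rep ↔ p.submodule ≤ K := by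
        rw [le_cut_iff, submodule_le_iff_rep_mem, hK, LinearMap.mem_ker]
        exact ⟨fun ⟨_, h⟩ => h, fun h => ⟨hP, h⟩⟩
      simp [chi, this]
    rw [hsum, chi_of_le hPU]
    by_cases hPB : P.submodule ≤ B
    · have : K = ⊤ := by rw [hK, hx0.2 hPB, map_zero, LinearMap.ker_zero]
      rw [chi_of_le hPB, this, finrank_top, hd, qNumber_succ']
      simp [add_comm]
    · have h1 : Module.finrank F K + 1 = m + 1 := by
        rw [← hd]
        refine Module.Dual.finrank_ker_add_one_of_ne_zero fun h0 => hPB (hx0.1 ?_)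
        exact (Module.forall_dual_apply_eq_zero_iff F x).1 fun φ => DFunLike.congr_fun h0 φ
      rw [chi_of_not_le hPB, Nat.succ.inj h1]
      simp
  · rw [chi_of_not_le hPU, chi_of_not_le fun h => hPU (h.trans hBU)]
    simp only [smul_zero, add_zero]
    refine Finset.sum_eq_zero fun p _ => chi_of_not_le fun h => hPU ?_
    exact (submodule_le_iff_rep_mem P U).2 ((le_cut_iff _ _).1 h).1

/-- A submodule of functions containing all `χ_H` for the hyperplanes `H` of `U` also contains
the combinations of `χ_U` and `χ_B` obtained by summing over the hyperplanes through `B`. -/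
lemma smul_chi_add_smul_chi_mem [Finite F] [FiniteDimensional F V]
    {N : Submodule ℤ (ℙ F V → ℤ)} {B U : Submodule F V}
    (hBU : B ≤ U) {m : ℕ} (hm : Module.finrank F U = Module.finrank F B + (m + 1))
    (hN : ∀ H : Submodule F V, Module.finrank F H + 1 = Module.finrank F U → chi H ∈ N) :
    qNumber (Nat.card F) m • chi U + (Nat.card F) ^ m • chi B ∈ N := by
  have : Finite (Module.Dual F (U ⧸ B.comap U.subtype)) := Module.finite_of_finite F
  have := Fintype.ofFinite (ℙ F (Module.Dual F (U ⧸ B.comap U.subtype)))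
  rw [← sum_chi_cut hBU hm]
  exact N.sum_mem fun p _ => hN _ (finrank_cut p.rep_nonzero)

/-! ### Subspaces of prescribed dimension and flags -/

lemma exists_le_finrank_eq [FiniteDimensional F V] (A : Submodule F V) {n : ℕ}
    (hA : Module.finrank F A ≤ n) (hn : n ≤ Module.finrank F V) :
    ∃ W : Submodule F V, A ≤ W ∧ Module.finrank F W = n := by
  induction n, hA using Nat.le_induction with
  | base => exact ⟨A, le_rfl, rfl⟩
  | succ n _ ih =>
    obtain ⟨W, hAW, hW⟩ := ih (by omega)
    have hlt : W < ⊤ := lt_top_iff_ne_top.2 fun h => by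
      rw [h, finrank_top] at hW; omega
    obtain ⟨v, -, hv⟩ := SetLike.exists_of_lt hlt
    refine ⟨W ⊔ F ∙ v, hAW.trans le_sup_left, ?_⟩
    have hv0 : v ≠ 0 := fun h => hv (h ▸ W.zero_mem)
    have h1 := Submodule.finrank_sup_add_finrank_inf_eq W (F ∙ v)
    have h2 : W ⊓ F ∙ v = ⊥ := by
      rw [← disjoint_iff]
      exact (Submodule.disjoint_span_singleton' hv0).2 hv
    rw [h2, finrank_bot, finrank_span_singleton hv0] at h1
    omega

lemma exists_isFlag (F V : Type*) [Field F] [AddCommGroup V] [Module F V]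
    [FiniteDimensional F V] : ∃ S : ℕ → Submodule F V, IsFlag S := by
  let b := Module.finBasis F V
  refine ⟨fun i => Submodule.span F (Set.image b {j | (j : ℕ) < i}), fun i _ j _ hij =>
    Submodule.span_mono (Set.image_mono fun k (hk : (k : ℕ) < i) => hk.trans_le hij), ?_⟩
  rintro i ⟨-, hi⟩
  have hcard := finrank_span_eq_card (R := F)
    (b.linearIndependent.comp (Subtype.val : {j : Fin _ | (j : ℕ) < i} → Fin _) Subtype.val_injective)
  rw [Set.range_comp, Subtype.range_coe] at hcard
  refine hcard.trans ?_
  simp only [Set.coe_ofPred, Fintype.card_subtype, Fin.card_filter_val_lt]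
  omega

/-! ### The lattice of h-spaces modulo degree -/

/-- The lattice generated by the characteristic functions of the `h`-spaces of `V`. -/
def spaceLattice (F V : Type*) [Field F] [AddCommGroup V] [Module F V] (h : ℕ) :
    Submodule ℤ (ℙ F V → ℤ) :=
  Submodule.span ℤ (Set.range fun S : {S : Submodule F V // Module.finrank F S = h} => chi S.1)

lemma chi_mem_spaceLattice {h : ℕ} {S : Submodule F V} (hS : Module.finrank F S = h) :
    chi S ∈ spaceLattice F V h :=
  Submodule.subset_span ⟨⟨S, hS⟩, rfl⟩

/-- The functions that are congruent to their degree times `w` modulo the lattice of `h`-spaces. -/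
def congruentToDegree [Fintype (ℙ F V)] (h : ℕ) (w : ℙ F V → ℤ) : Submodule ℤ (ℙ F V → ℤ) :=
  (spaceLattice F V h).comap (LinearMap.id - (degree F V).smulRight w)

lemma mem_congruentToDegree [Fintype (ℙ F V)] {h : ℕ} {w f : ℙ F V → ℤ} :
    f ∈ congruentToDegree h w ↔ f - degree F V f • w ∈ spaceLattice F V h := Iff.rfl

section Finite

variable [Finite F] [FiniteDimensional F V]

/-- Each point of W lies on [h] of its hyperplanes, so this is the sum over all of them (B = ⊥). -/
lemma qNumber_smul_chi_mem_spaceLattice {h : ℕ} {W : Submodule F V}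
    (hW : Module.finrank F W = h + 1) :
    qNumber (Nat.card F) h • chi W ∈ spaceLattice F V h := by
  have := smul_chi_add_smul_chi_mem (N := spaceLattice F V h) (bot_le : ⊥ ≤ W) (m := h)
    (by rw [hW, finrank_bot, zero_add]) fun H hH => chi_mem_spaceLattice (by omega)
  simpa [chi_bot] using this

lemma spaceLattice_le_congruentToDegree [Fintype (ℙ F V)] {h : ℕ} {W : Submodule F V}
    (hW : Module.finrank F W = h + 1) :
    spaceLattice F V h ≤ congruentToDegree h (chi W) := by
  refine Submodule.span_le.2 ?_
  rintro _ ⟨⟨S, hS⟩, rfl⟩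
  refine mem_congruentToDegree.2 (Submodule.sub_mem _ (chi_mem_spaceLattice hS) ?_)
  rw [degree_chi, hS, natCast_zsmul]
  exact qNumber_smul_chi_mem_spaceLattice hW

/-- For a point B of W, subtracting [h] χ_W from the sum over the `h`-spaces of W through B leaves
q^(h-1) (χ_B - χ_W). An arbitrary point A is compared with B inside a common (h+1)-space. -/
lemma smul_chi_point_mem [Fintype (ℙ F V)] {h : ℕ} (hh : 1 ≤ h) {W : Submodule F V}
    (hW : Module.finrank F W = h + 1) {A : Submodule F V} (hA : Module.finrank F A = 1) :
    Nat.card F ^ (h - 1) • chi A ∈ congruentToDegree h (chi W) := by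
  have key : ∀ {U B : Submodule F V}, B ≤ U → Module.finrank F U = h + 1 →
      Module.finrank F B = 1 → qNumber (Nat.card F) (h - 1) • chi U +
        Nat.card F ^ (h - 1) • chi B ∈ spaceLattice F V h := fun hBU hU hB =>
    smul_chi_add_smul_chi_mem hBU (by omega) fun H hH => chi_mem_spaceLattice (by omega)
  obtain ⟨v, hv0⟩ := Module.finrank_pos_iff_exists_ne_zero.1 (by omega : 0 < Module.finrank F W)
  have hB : Module.finrank F (F ∙ (v : V)) = 1 :=
    finrank_span_singleton fun h0 => hv0 (Subtype.ext h0)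
  have hBW : F ∙ (v : V) ≤ W := (Submodule.span_singleton_le_iff_mem _ _).2 v.2
  generalize F ∙ (v : V) = B at hB hBW
  have hBmem : Nat.card F ^ (h - 1) • chi B ∈ congruentToDegree h (chi W) := by
    rw [mem_congruentToDegree, map_nsmul, degree_chi, hB]
    convert Submodule.sub_mem _ (key hBW hW hB) (qNumber_smul_chi_mem_spaceLattice hW) using 1
    obtain ⟨k, rfl⟩ := Nat.exists_eq_add_of_le' hh
    rw [qNumber_succ' _ k, qNumber_one]
    funext P
    simp
    ring
  obtain ⟨U, hU, hUd⟩ := exists_le_finrank_eq (A ⊔ B) (n := h + 1)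
    (by have := Submodule.finrank_add_le_finrank_add_finrank A B; omega)
    (by have := Submodule.finrank_le W; omega)
  have hdiff := spaceLattice_le_congruentToDegree hW <| Submodule.sub_mem _
    (key (le_sup_left.trans hU) hUd hA) (key (le_sup_right.trans hU) hUd hB)
  rw [add_sub_add_left_eq_sub] at hdiff
  simpa using Submodule.add_mem _ hdiff hBmem

/-- Induction on dim U = u + 1: summing over all hyperplanes of U yields [u] χ_U, and over those
through a point, with the point term removed, [u-1] χ_U. Since [u] - q [u-1] = 1, χ_U itself
follows. -/
lemma chi_mem_congruentToDegree [Fintype (ℙ F V)] {h : ℕ} (hh : 1 ≤ h) {W : Submodule F V}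
    (hW : Module.finrank F W = h + 1) {U : Submodule F V} (hU : h ≤ Module.finrank F U) :
    chi U ∈ congruentToDegree h (chi W) := by
  obtain ⟨u, hu⟩ : ∃ u, Module.finrank F U = u := ⟨_, rfl⟩
  rw [hu] at hU
  induction u, hU using Nat.le_induction generalizing U with
  | base => exact spaceLattice_le_congruentToDegree hW (chi_mem_spaceLattice hu)
  | succ u hhu ih =>
    have hN : ∀ H : Submodule F V, Module.finrank F H + 1 = Module.finrank F U →
        chi H ∈ congruentToDegree h (chi W) := fun H hH => ih (by omega)
    have h0 : qNumber (Nat.card F) u • chi U ∈ congruentToDegree h (chi W) := by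
      have := smul_chi_add_smul_chi_mem (bot_le : ⊥ ≤ U) (m := u)
        (by rw [hu, finrank_bot, zero_add]) hN
      simpa [chi_bot] using this
    obtain ⟨v, hv0⟩ := Module.finrank_pos_iff_exists_ne_zero.1 (by omega : 0 < Module.finrank F U)
    have hB : Module.finrank F (F ∙ (v : V)) = 1 :=
      finrank_span_singleton fun h0 => hv0 (Subtype.ext h0)
    have hBU : F ∙ (v : V) ≤ U := (Submodule.span_singleton_le_iff_mem _ _).2 v.2
    obtain ⟨k, rfl⟩ := Nat.exists_eq_add_of_le hhu
    have h1 := smul_chi_add_smul_chi_mem hBU (m := h + k - 1) (by omega) hN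
    have h2 := nsmul_mem (smul_chi_point_mem hh hW hB) (Nat.card F ^ k)
    rw [smul_smul, ← pow_add, show k + (h - 1) = h + k - 1 by omega] at h2
    have h3 := nsmul_mem (Submodule.sub_mem _ h1 h2) (Nat.card F)
    rw [add_sub_cancel_right, smul_smul] at h3
    have h4 := Submodule.sub_mem _ h0 h3
    rw [show h + k = (h + k - 1) + 1 by omega, qNumber_succ, Nat.add_sub_cancel, add_smul,
      add_sub_cancel_left, one_smul] at h4
    exact h4

lemma pow_smul_chi_mem_congruentToDegree [Fintype (ℙ F V)] {h : ℕ} (hh : 1 ≤ h)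
    {W : Submodule F V} (hW : Module.finrank F W = h + 1) {A : Submodule F V}
    (hA : Module.finrank F A ≤ h) :
    Nat.card F ^ (h - Module.finrank F A) • chi A ∈ congruentToDegree h (chi W) := by
  obtain ⟨U, hAU, hU⟩ := exists_le_finrank_eq A (n := h + 1) (by omega)
    (by have := Submodule.finrank_le W; omega)
  have h1 := smul_chi_add_smul_chi_mem hAU (m := h - Module.finrank F A) (by omega)
    fun H hH => spaceLattice_le_congruentToDegree hW (chi_mem_spaceLattice (by omega))
  have h2 := nsmul_mem (chi_mem_congruentToDegree hh hW (U := U) (by omega))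
    (qNumber (Nat.card F) (h - Module.finrank F A))
  simpa using Submodule.sub_mem _ h1 h2

/-- The divisibility and degree conditions imply membership in the lattice of `h`-spaces. -/
lemma smul_chi_top_sub_sum_mem_spaceLattice {h : ℕ} (hh : 1 ≤ h) (hhr : h < Module.finrank F V)
    {ε : ℕ → ℤ} (hε : ∀ i, 1 ≤ i → i < h → (Nat.card F : ℤ) ^ (h - i) ∣ ε i)
    {S : ℕ → Submodule F V} (hS : IsFlag S) {σ : ℤ}
    (hdeg : (qNumber (Nat.card F) h : ℤ) ∣ σ * qNumber (Nat.card F) (Module.finrank F V) -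
      ∑ i ∈ Finset.Ico 1 (Module.finrank F V), ε i * qNumber (Nat.card F) i) :
    σ • chi (⊤ : Submodule F V) - ∑ i ∈ Finset.Ico 1 (Module.finrank F V), ε i • chi (S i) ∈
      spaceLattice F V h := by
  have : Finite V := Module.finite_of_finite F
  have := Fintype.ofFinite (ℙ F V)
  obtain ⟨W, -, hW⟩ := exists_le_finrank_eq (⊥ : Submodule F V) (n := h + 1) (by simp) hhr
  have hmem : σ • chi (⊤ : Submodule F V) -
      ∑ i ∈ Finset.Ico 1 (Module.finrank F V), ε i • chi (S i) ∈ congruentToDegree h (chi W) := by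
    refine Submodule.sub_mem _ (Submodule.smul_mem _ _ ?_) (Submodule.sum_mem _ fun i hi => ?_)
    · exact chi_mem_congruentToDegree hh hW (by rw [finrank_top]; exact hhr.le)
    · rw [Finset.mem_Ico] at hi
      have hSi := hS.2 i hi
      rcases lt_or_ge i h with hih | hih
      · obtain ⟨c, hc⟩ := hε i hi.1 hih
        have := pow_smul_chi_mem_congruentToDegree hh hW (A := S i) (by omega)
        rw [hc, mul_comm, mul_smul]
        rw [hSi, ← natCast_zsmul, Nat.cast_pow] at this
        exact Submodule.smul_mem _ _ this
      · exact Submodule.smul_mem _ _ (chi_mem_congruentToDegree hh hW (by omega))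
  have hd : degree F V (σ • chi (⊤ : Submodule F V) -
      ∑ i ∈ Finset.Ico 1 (Module.finrank F V), ε i • chi (S i)) =
      σ * qNumber (Nat.card F) (Module.finrank F V) -
      ∑ i ∈ Finset.Ico 1 (Module.finrank F V), ε i * qNumber (Nat.card F) i := by
    rw [map_sub, map_smul, map_sum, degree_chi, finrank_top, smul_eq_mul]
    congr 1
    refine Finset.sum_congr rfl fun i hi => ?_
    rw [map_smul, degree_chi, hS.2 i (by simpa using hi), smul_eq_mul]
  obtain ⟨c, hc⟩ := hdeg
  rw [mem_congruentToDegree, hd, hc, mul_comm, mul_smul, natCast_zsmul] at hmem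
  have := Submodule.add_mem _ hmem (Submodule.smul_mem _ c (qNumber_smul_chi_mem_spaceLattice hW))
  rwa [sub_add_cancel] at this

end Finite

/-! ### From lattice elements to multisets of h-spaces -/

lemma exists_linearEquiv_map_submodule_eq (P Q : ℙ F V) :
    ∃ e : V ≃ₗ[F] V, P.submodule.map (e : V →ₗ[F] V) = Q.submodule := by
  have : MulAction.IsPretransitive (V ≃ₗ[F] V) (ℙ F V) :=
    MulAction.isPretransitive_of_is_two_pretransitive
  obtain ⟨e, he⟩ := MulAction.exists_smul_eq (V ≃ₗ[F] V) P Q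
  refine ⟨e, ?_⟩
  rw [← he]
  induction P using Projectivization.ind with
  | h v hv =>
    rw [Projectivization.smul_mk, Projectivization.submodule_mk, Projectivization.submodule_mk,
      Submodule.map_span, Set.image_singleton]
    rfl

/-- The `h`-spaces cover every point equally often. -/
lemma exists_sum_chi_eq_smul_chi_top (h : ℕ)
    [Fintype {S : Submodule F V // Module.finrank F S = h}] :
    ∃ c : ℕ, ∑ S : {S : Submodule F V // Module.finrank F S = h}, chi S.1 =
      c • chi (⊤ : Submodule F V) := by
  classical
  rcases isEmpty_or_nonempty (ℙ F V) with hE | ⟨⟨P⟩⟩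
  · exact ⟨0, funext fun P => (hE.false P).elim⟩
  refine ⟨(Finset.univ.filter fun S : {S : Submodule F V // Module.finrank F S = h} =>
    P.submodule ≤ S.1).card, funext fun Q => ?_⟩
  obtain ⟨e, he⟩ := exists_linearEquiv_map_submodule_eq P Q
  -- An automorphism taking P to Q permutes the `h`-spaces.
  have hperm : ∑ S : {S : Submodule F V // Module.finrank F S = h}, chi S.1 P =
      ∑ S : {S : Submodule F V // Module.finrank F S = h}, chi S.1 Q := by
    refine Fintype.sum_equiv ((Submodule.orderIsoMapComap e).toEquiv.subtypeEquiv fun S => ?_) _ _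
      fun S => ?_
    · change _ ↔ Module.finrank F (S.map (e : V →ₗ[F] V)) = h
      rw [LinearEquiv.finrank_map_eq]
    · have : P.submodule ≤ S.1 ↔ Q.submodule ≤ S.1.map (e : V →ₗ[F] V) := by
        rw [← he]
        exact (Submodule.map_le_map_iff_of_injective e.injective _ _).symm
      change chi S.1 P = chi (S.1.map (e : V →ₗ[F] V)) Q
      simp [chi, this]
  rw [Finset.sum_apply, ← hperm, Pi.smul_apply, chi_top]
  simp [chi]

/-- A member of the lattice of `h`-spaces becomes a sum over a multiset of `h`-spaces after adding
a multiple of `χ_V`. -/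
lemma exists_multiset_of_mem_spaceLattice [Finite F] [FiniteDimensional F V] {h : ℕ}
    {f : ℙ F V → ℤ} (hf : f ∈ spaceLattice F V h) :
    ∃ (m : ℕ) (𝒮 : Multiset (Submodule F V)), (∀ S ∈ 𝒮, Module.finrank F S = h) ∧
      (𝒮.map chi).sum = f + m • chi (⊤ : Submodule F V) := by
  classical
  have : Finite V := Module.finite_of_finite F
  have := Fintype.ofFinite {S : Submodule F V // Module.finrank F S = h}
  obtain ⟨a, rfl⟩ := (Submodule.mem_span_range_iff_exists_fun ℤ).1 hf
  obtain ⟨c, hc⟩ := exists_sum_chi_eq_smul_chi_top (F := F) (V := V) h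
  -- k bounds every |a S|, so adding it to all coefficients makes them nonnegative and adds only k c
  -- χ_V.
  let k : ℕ := ∑ S, (a S).natAbs
  have hk : ∀ S, 0 ≤ a S + k := fun S => by
    have := Finset.single_le_sum (f := fun S => (a S).natAbs) (fun _ _ => Nat.zero_le _)
      (Finset.mem_univ S)
    change (a S).natAbs ≤ k at this
    omega
  refine ⟨k * c, ∑ S : {S : Submodule F V // Module.finrank F S = h},
    (a S + k).toNat • ({S.1} : Multiset (Submodule F V)), ?_, ?_⟩
  · intro T hT
    obtain ⟨S, -, hS⟩ := Multiset.mem_sum.1 hT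
    rw [Multiset.mem_singleton.1 (Multiset.mem_of_mem_nsmul hS)]
    exact S.2
  · rw [← Multiset.coe_mapAddMonoidHom, map_sum, ← Multiset.coe_sumAddMonoidHom, map_sum,
      mul_smul, ← hc, Finset.smul_sum, ← Finset.sum_add_distrib]
    refine Finset.sum_congr rfl fun S _ => ?_
    rw [map_nsmul, map_nsmul, ← natCast_zsmul, Int.toNat_of_nonneg (hk S), add_smul,
      natCast_zsmul]
    simp

/-- Every multiset of `h`-spaces is a faithful projective system. -/
lemma exists_isFaithfulProjectiveSystem [FiniteDimensional F V] (hV : 0 < Module.finrank F V)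
    {h : ℕ} {𝒮 : Multiset (Submodule F V)} (h𝒮 : ∀ S ∈ 𝒮, Module.finrank F S = h) :
    ∃ n s, IsFaithfulProjectiveSystem h n s 𝒮 := by
  classical
  obtain ⟨H₀, -, hH₀⟩ := exists_le_finrank_eq (⊥ : Submodule F V)
    (n := Module.finrank F V - 1) (by simp) (by omega)
  -- The parameter s is the maximum of this set; `H₀` shows that the set is nonempty.
  let T : Set ℕ := {s | ∃ H : Submodule F V, IsHyperplane H ∧ numContained 𝒮 H = s}
  have hT : T.Nonempty := ⟨_, H₀, by rw [IsHyperplane]; omega, rfl⟩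
  have hbdd : BddAbove T := by
    refine ⟨Multiset.card 𝒮, ?_⟩
    rintro _ ⟨H, -, rfl⟩
    exact Multiset.card_le_card (Multiset.filter_le _ _)
  exact ⟨_, sSup T, ⟨⟨rfl, fun S hS => (h𝒮 S hS).le, fun H hH => le_csSup hbdd ⟨H, hH, rfl⟩,
    Nat.sSup_mem hT hbdd⟩, h𝒮⟩⟩

/-! ### Necessity of the two conditions -/

/-- The sum of a function over the points outside the kernel of a linear form. -/
def degreeOutside [Fintype (ℙ F V)] (φ : Module.Dual F V) : (ℙ F V → ℤ) →ₗ[ℤ] ℤ :=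
  degree F V - degree F V ∘ₗ LinearMap.mulRight ℤ (chi (LinearMap.ker φ))

lemma degreeOutside_chi [Finite F] [FiniteDimensional F V] [Fintype (ℙ F V)]
    (φ : Module.Dual F V) (S : Submodule F V) [Decidable (S ≤ LinearMap.ker φ)] :
    degreeOutside φ (chi S) =
      if S ≤ LinearMap.ker φ then 0 else (Nat.card F : ℤ) ^ (Module.finrank F S - 1) := by
  have h1 : degreeOutside φ (chi S) = degree F V (chi S) -
      degree F V (chi (S ⊓ LinearMap.ker φ)) := by rw [chi_inf]; rfl
  rw [h1, degree_chi, degree_chi]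
  split_ifs with hS
  · rw [inf_eq_left.2 hS, sub_self]
  · have h2 : LinearMap.ker (φ ∘ₗ S.subtype) = (S ⊓ LinearMap.ker φ).comap S.subtype := by
      ext x; simp
    have h3 : Module.finrank F (LinearMap.ker (φ ∘ₗ S.subtype)) + 1 = Module.finrank F S := by
      refine Module.Dual.finrank_ker_add_one_of_ne_zero fun h0 => hS fun x hx => ?_
      exact DFunLike.congr_fun h0 (⟨x, hx⟩ : S)
    rw [h2, (Submodule.comapSubtypeEquivOfLe inf_le_left).finrank_eq] at h3
    rw [← h3, qNumber_succ', Nat.add_sub_cancel]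
    push_cast
    ring

lemma dvd_of_hasType [Finite F] [FiniteDimensional F V] {h : ℕ} {𝒮 : Multiset (Submodule F V)}
    (h𝒮 : ∀ S ∈ 𝒮, Module.finrank F S = h) {σ : ℕ} {ε : ℕ → ℤ} (hT : HasType 𝒮 σ ε)
    (hhr : h < Module.finrank F V) {i : ℕ} (hi : 1 ≤ i) (hih : i < h) :
    (Nat.card F : ℤ) ^ (h - i) ∣ ε i := by
  classical
  have : Finite V := Module.finite_of_finite F
  have := Fintype.ofFinite (ℙ F V)
  obtain ⟨S, ⟨hmono, hdim⟩, hsum⟩ := hT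
  have hdvd : ∀ φ : Module.Dual F V,
      (Nat.card F : ℤ) ^ (h - 1) ∣ degreeOutside φ (𝒮.map chi).sum := by
    intro φ
    rw [map_multiset_sum, Multiset.map_map]
    refine Multiset.dvd_sum fun x hx => ?_
    obtain ⟨T, hT, rfl⟩ := Multiset.mem_map.1 hx
    rw [Function.comp_apply, degreeOutside_chi, h𝒮 T hT]
    split_ifs
    exacts [dvd_zero _, dvd_rfl]
  have hlt : ∀ {A B : Submodule F V}, Module.finrank F A < Module.finrank F B →
      ∃ φ : Module.Dual F V, A ≤ LinearMap.ker φ ∧ ¬ B ≤ LinearMap.ker φ := by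
    intro A B hAB
    obtain ⟨v, hvB, hvA⟩ := SetLike.not_le_iff_exists.1
      fun hle : B ≤ A => hAB.not_ge (Submodule.finrank_mono hle)
    obtain ⟨φ, hφ, hA⟩ := Submodule.exists_le_ker_of_notMem hvA
    exact ⟨φ, hA, fun hB => hφ (hB hvB)⟩
  have hm : ∀ {j k}, 1 ≤ j → j ≤ k → k < Module.finrank F V → S j ≤ S k := fun h1 h2 h3 =>
    hmono ⟨h1, h2.trans_lt h3⟩ ⟨h1.trans h2, h3⟩ h2
  obtain ⟨φ, hφ, hφ'⟩ : ∃ φ : Module.Dual F V, (∀ j, 1 ≤ j → j < i → S j ≤ LinearMap.ker φ) ∧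
      ¬ S i ≤ LinearMap.ker φ := by
    -- `S 0` is unconstrained by `IsFlag`, so ⊥ takes its place when i = 1.
    rcases hi.eq_or_lt with rfl | hi1
    · obtain ⟨φ, -, hφ⟩ := hlt (A := ⊥) (B := S 1)
        (by rw [finrank_bot, hdim 1 ⟨le_rfl, by omega⟩]; exact one_pos)
      exact ⟨φ, fun j h1 h2 => absurd h2 (by omega), hφ⟩
    · obtain ⟨φ, h1, hφ⟩ := hlt (A := S (i - 1)) (B := S i)
        (by rw [hdim i ⟨hi, by omega⟩, hdim _ ⟨by omega, by omega⟩]; omega)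
      exact ⟨φ, fun j hj hji => (hm hj (by omega) (by omega)).trans h1, hφ⟩
  obtain ⟨ψ, hψ, hψ'⟩ := hlt (A := S i) (B := S (i + 1))
    (by rw [hdim i ⟨hi, by omega⟩, hdim _ ⟨by omega, by omega⟩]; omega)
  -- χ_V and the S_j with j > i lie in neither kernel and cancel; the S_j with j < i lie in both and
  -- contribute 0.
  have hdiff : degreeOutside φ (𝒮.map chi).sum - degreeOutside ψ (𝒮.map chi).sum =
      -(ε i * (Nat.card F : ℤ) ^ (i - 1)) := by
    have htop : ∀ {χ : Module.Dual F V} {k}, ¬ S k ≤ LinearMap.ker χ →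
        ¬ (⊤ : Submodule F V) ≤ LinearMap.ker χ := fun h1 h2 => h1 (le_top.trans h2)
    rw [hsum, map_sub, map_sub, map_smul, map_smul, degreeOutside_chi, degreeOutside_chi,
      if_neg (htop hφ'), if_neg (htop hψ'), sub_sub_sub_cancel_left, map_sum, map_sum,
      ← Finset.sum_sub_distrib, Finset.sum_eq_single i]
    · rw [map_smul, map_smul, degreeOutside_chi, degreeOutside_chi, if_pos hψ, if_neg hφ',
        hdim i ⟨hi, by omega⟩]
      simp
    · intro j hj hji
      rw [Finset.mem_Ico] at hj
      rw [map_smul, map_smul, degreeOutside_chi, degreeOutside_chi]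
      rcases lt_or_gt_of_ne hji with hlt | hgt
      · rw [if_pos (hφ j hj.1 hlt), if_pos ((hm hj.1 hlt.le (by omega)).trans hψ), sub_self]
      · rw [if_neg fun h1 => hφ' ((hm hi hgt.le hj.2).trans h1),
          if_neg fun h1 => hψ' ((hm (by omega) hgt hj.2).trans h1), sub_self]
    · exact fun h1 => absurd (Finset.mem_Ico.2 ⟨hi, by omega⟩) h1
  have h1 := dvd_sub (hdvd φ) (hdvd ψ)
  rw [hdiff, dvd_neg, show h - 1 = (h - i) + (i - 1) by omega, pow_add] at h1
  exact (mul_dvd_mul_iff_right (pow_ne_zero _ (by exact_mod_cast Nat.card_pos.ne'))).1 h1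

lemma modEq_of_hasType [Finite F] [FiniteDimensional F V] {h : ℕ}
    {𝒮 : Multiset (Submodule F V)} (h𝒮 : ∀ S ∈ 𝒮, Module.finrank F S = h) {σ : ℕ} {ε : ℕ → ℤ}
    (hT : HasType 𝒮 σ ε) :
    (∑ i ∈ Finset.Ico 1 (Module.finrank F V), ε i * (qNumber (Nat.card F) i : ℤ)) ≡ 0
      [ZMOD (qNumber (Nat.card F) (Nat.gcd (Module.finrank F V) h) : ℤ)] := by
  have : Finite V := Module.finite_of_finite F
  have := Fintype.ofFinite (ℙ F V)
  obtain ⟨S, ⟨-, hdim⟩, hsum⟩ := hT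
  rw [← gcd_qNumber Finite.one_lt_card, Int.modEq_zero_iff_dvd]
  have h1 := congrArg (degree F V) hsum
  rw [map_sub, map_smul, map_sum, degree_chi, finrank_top, smul_eq_mul, map_multiset_sum,
    Multiset.map_map] at h1
  have h2 : (qNumber (Nat.card F) h : ℤ) ∣
      (𝒮.map (degree F V ∘ chi)).sum := by
    refine Multiset.dvd_sum fun x hx => ?_
    obtain ⟨T, hT, rfl⟩ := Multiset.mem_map.1 hx
    rw [Function.comp_apply, degree_chi, h𝒮 T hT]
  have h3 : ∑ i ∈ Finset.Ico 1 (Module.finrank F V), degree F V (ε i • chi (S i)) =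
      ∑ i ∈ Finset.Ico 1 (Module.finrank F V), ε i * (qNumber (Nat.card F) i : ℤ) := by
    refine Finset.sum_congr rfl fun i hi => ?_
    rw [map_smul, degree_chi, hdim i (by simpa using hi), smul_eq_mul]
  rw [h3, eq_sub_iff_add_eq', ← eq_sub_iff_add_eq] at h1
  rw [h1]
  exact dvd_sub (Dvd.dvd.mul_left (Int.natCast_dvd_natCast.2 (Nat.gcd_dvd_left _ _)) _)
    ((Int.natCast_dvd_natCast.2 (Nat.gcd_dvd_right _ _)).trans h2)

/-! ### Choice of σ and conclusion -/

/-- A solvable linear congruence has a natural solution. -/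
lemma exists_nat_dvd_mul_sub {a b : ℕ} (hb : 0 < b) {t : ℤ} (ht : (Nat.gcd a b : ℤ) ∣ t) :
    ∃ σ : ℕ, (b : ℤ) ∣ (σ : ℤ) * a - t := by
  obtain ⟨c, rfl⟩ := ht
  -- The Bézout solution is reduced modulo b to make it nonnegative.
  refine ⟨((Nat.gcdA a b * c) % b).toNat, ?_⟩
  rw [Int.toNat_of_nonneg (Int.emod_nonneg _ (by omega)), Nat.gcd_eq_gcd_ab, Int.emod_def]
  exact ⟨-(Nat.gcdA a b * c / b) * a - Nat.gcdB a b * c, by ring⟩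

end AdditiveCodes

end

theorem mainTheorem2 {F V : Type*} [Field F] [Finite F] [AddCommGroup V] [Module F V]
    (q r h : ℕ) (hq : Nat.card F = q) (hr : Module.finrank F V = r)
    (hh : 1 ≤ h) (hhr : h < r) (ε : ℕ → ℤ) :
    AdditiveCodes.IsStarPartitionable F V h ε ↔
      (∀ i : ℕ, 1 ≤ i → i < h → (q : ℤ) ^ (h - i) ∣ ε i) ∧
        (∑ i ∈ Finset.Ico 1 r, ε i * (AdditiveCodes.qNumber q i : ℤ)) ≡ 0
          [ZMOD (AdditiveCodes.qNumber q (Nat.gcd r h) : ℤ)] := by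
  subst hq hr
  have : FiniteDimensional F V := Module.finite_of_finrank_pos (by omega)
  constructor
  · rintro ⟨σ, n, s, 𝒮, h𝒮, hT⟩
    exact ⟨fun i => AdditiveCodes.dvd_of_hasType h𝒮.finrank_eq hT hhr,
      AdditiveCodes.modEq_of_hasType h𝒮.finrank_eq hT⟩
  · rintro ⟨hε, hsum⟩
    rw [← AdditiveCodes.gcd_qNumber Finite.one_lt_card, Int.modEq_zero_iff_dvd] at hsum
    have hpos : 0 < AdditiveCodes.qNumber (Nat.card F) h := by
      obtain ⟨k, rfl⟩ := Nat.exists_eq_add_of_le' hh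
      rw [AdditiveCodes.qNumber_succ]
      exact Nat.succ_pos _
    obtain ⟨σ, hσ⟩ := AdditiveCodes.exists_nat_dvd_mul_sub hpos hsum
    obtain ⟨S, hS⟩ := AdditiveCodes.exists_isFlag F V
    obtain ⟨m, 𝒮, h𝒮, hm⟩ := AdditiveCodes.exists_multiset_of_mem_spaceLattice
      (AdditiveCodes.smul_chi_top_sub_sum_mem_spaceLattice hh hhr hε hS hσ)
    obtain ⟨n, s, hns⟩ := AdditiveCodes.exists_isFaithfulProjectiveSystem (by omega) h𝒮
    -- The m copies of χ_V added for positivity are absorbed into σ.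
    refine ⟨σ + m, n, s, 𝒮, hns, S, hS, ?_⟩
    rw [hm, Nat.cast_add, add_smul, natCast_zsmul, natCast_zsmul]
    abel
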